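/- Let $\mathcal X,\mathcal Y$ be finite alphabets with $|\mathcal X|\ge 2$, let $P_X$ be a probability mass function on $\mathcal X$ and $P_{Y\mid X}$ a transition probability from $\mathcal X$ to $\mathcal Y$. All logarithms, including the one in the mutual information, are to the base $|\mathcal X|$. Let $\beta>0$ be fixed, and let the read length $\ell=\ell(n)$ be a sequence of non-negative integers with $\ell(n)/\log n\to\beta$ (for example $\ell=\beta\log n$ rounded to an integer). **Model.** The source $(X_i)_{i\in\mathbb Z}$ is i.i.d. with law $P_X$ (only $X_{2-\ell},\dots,X_{n+2\ell-2}$ is used). Independently of the source, a first starting index $I(1)\in\{1,\dots,n\}$ is drawn from the uniform law or from any other law on $\{1,\dots,n\}$, and, given $I(1)$, the second starting index $I(2)$ is uniform on a window of $n$ integers: on $I(1)+\{-\ell+1,\dots,n-\ell\}$ if $I(1)\le\ell-1$, on $\{1,\dots,n\}$ if $\ell\le I(1)\le n-\ell+1$, and on $I(1)+\{\ell-n,\dots,\ell-1\}$ if $I(1)\ge n-\ell+2$ (these cases are exclusive as soon as $n\ge 2\ell-2$, hence for all large $n$). For $j=1,2$ the read $(X_{I(j)},\dots,X_{I(j)+\ell-1})$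 is passed through the memoryless channel $P_{Y\mid X}$, conditionally independently for the two reads, which gives the noisy reads $Y_1^\ell(1),Y_1^\ell(2)\in\mathcal Y^\ell$. The signed overlap is $$T=\begin{cases}\max\{0,\ell-(I(2)-I(1))\}, & I(2)\ge I(1),\\ -\max\{0,\ell-(I(1)-I(2))\}, & I(2)<I(1).\end{cases}$$ Let $$P^*_{\mathrm{error}}=P^*_{\mathrm{error}}(n)=\min_{\hat T}\ \mathbb P\big[\hat T(Y_1^\ell(1),Y_1^\ell(2))\ne T\big],$$ the minimum being over all maps $\hat T:\mathcal Y^\ell\times\mathcal Y^\ell\to\{-(\ell-1),\dots,-1\}\cup\{0\}\cup\{1,\dots,\ell\}$. Let $(Y,\tilde Y)$ have the law $P_{Y\tilde Y}(y,\tilde y)=\sum_{x}P_X(x)P_{Y\mid X}(y\mid x)P_{Y\mid X}(\tilde y\mid x)$, that is, $Y$ and $\tilde Y$ are two conditionally independent channel outputs of the same symbol $X\sim P_X$, and let $I(Y;\tilde Y)$ be their mutual information. **Theorem.** As $n\to\infty$, $$P^*_{\mathrm{error}}\le 2\,[1+o_n(1)]\cdot\min\Big\{\beta,\frac1{I(Y;\tilde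 Y)}\Big\}\cdot\frac{\log n}{n},$$ where $1/I(Y;\tilde Y)=\infty$ if $I(Y;\tilde Y)=0$, and where the $o_n(1)$ term depends on $P_X$, $P_{Y\mid X}$, $\beta$ and the sequence $\ell$ only (not on the law of $I(1)$). -/

import Mathlib

open Filter Topology

namespace OverlapDetection

/-- The law of a family of independent random variables indexed by a finite type `ι`, the `i`-th
of which takes values in a finite alphabet `α` and has law `p i`. -/
noncomputable def productLaw {ι α : Type*} [Fintype ι] [DecidableEq ι] [Fintype α]
    (p : ι → PMF α) : PMF (ι → α) :=
  PMF.ofFintype (fun a => ∏ i, p i (a i)) (by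
    rw [← Fintype.piFinset_univ, ← Finset.prod_univ_sum]
    refine Finset.prod_eq_one fun i _ => ?_
    rw [← tsum_fintype (L := SummationFilter.unconditional α)]
    exact (p i).tsum_coe)

/-- The set `[n] = {1, …, n}` of values of the first starting index. -/
noncomputable def firstWindow (n : ℕ+) : Finset ℤ := Finset.Icc 1 (n : ℤ)

/-- The window of `n` consecutive integers over which the second starting index is uniform, given
that the first starting index is `i`. -/
noncomputable def secondWindow (n : ℕ+) (ℓ : ℕ) (i : ℤ) : Finset ℤ :=
  if i ≤ (ℓ : ℤ) - 1 then Finset.Icc (i - ℓ + 1) (i + n - ℓ)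
  else if i ≤ (n : ℤ) - ℓ + 1 then Finset.Icc 1 (n : ℤ)
  else Finset.Icc (i + ℓ - n) (i + ℓ - 1)

theorem secondWindow_nonempty (n : ℕ+) (ℓ : ℕ) (i : ℤ) : (secondWindow n ℓ i).Nonempty := by
  have hn : (0 : ℤ) < n := by exact_mod_cast n.pos
  unfold secondWindow
  split_ifs <;> rw [Finset.nonempty_Icc] <;> omega

/-- The positions of the (slightly extended) available sequence `X_{2-ℓ}, …, X_{n+2ℓ-2}`. -/
noncomputable def positions (n : ℕ+) (ℓ : ℕ) : Finset ℤ := Finset.Icc (2 - (ℓ : ℤ)) ((n : ℤ) + 2 * ℓ - 2)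

theorem first_mem_positions {n : ℕ+} {ℓ : ℕ} (i : firstWindow n) (k : Fin ℓ) :
    (i : ℤ) + (k : ℕ) ∈ positions n ℓ := by
  have hk := k.isLt
  have hi := i.2
  simp only [firstWindow, positions, Finset.mem_Icc] at hi ⊢
  omega

theorem second_mem_positions {n : ℕ+} {ℓ : ℕ} (i : firstWindow n)
    (j : secondWindow n ℓ (i : ℤ)) (k : Fin ℓ) : (j : ℤ) + (k : ℕ) ∈ positions n ℓ := by
  have hk := k.isLt
  have hi := i.2
  have hj := j.2
  simp only [firstWindow, secondWindow, positions, Finset.mem_Icc] at hi hj ⊢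
  split_ifs at hj <;> simp only [Finset.mem_Icc] at hj <;> omega

/-- The conditional law of the second starting index given the first one. -/
noncomputable def secondIndexLaw (n : ℕ+) (ℓ : ℕ) (i : ℤ) : PMF (secondWindow n ℓ i) :=
  haveI : Nonempty (secondWindow n ℓ i) := (secondWindow_nonempty n ℓ i).to_subtype
  PMF.uniformOfFintype (secondWindow n ℓ i)

/-- The signed overlap of two reads of length `ℓ` that start at `i` and `j`. -/
noncomputable def overlap (ℓ : ℕ) (i j : ℤ) : ℤ :=
  if i ≤ j then max 0 ((ℓ : ℤ) - (j - i)) else -max 0 ((ℓ : ℤ) - (i - j))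

/-- The set `{-(ℓ-1), …, -1} ∪ {0} ∪ {1, …, ℓ}` of possible overlaps. -/
def overlapSet (ℓ : ℕ) : Set ℤ := {t | (-(ℓ : ℤ) < t ∧ t < 0) ∨ t = 0 ∨ (0 < t ∧ t ≤ ℓ)}

/-- An overlap detector. -/
abbrev Detector (ℓ : ℕ) (𝒴 : Type*) := (Fin ℓ → 𝒴) → (Fin ℓ → 𝒴) → overlapSet ℓ

section Model

variable {𝒳 𝒴 : Type*} [Fintype 𝒳] [Fintype 𝒴]

/-- The joint law of `(T, Y(1), Y(2))`: the signed overlap and the two noisy reads, when the first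
starting index has law `Q`, the source is memoryless with letter law `P`, and both reads are passed
(conditionally independently) through the memoryless channel with letter transition law `W`. -/
noncomputable def readsLaw (n : ℕ+) (ℓ : ℕ) (Q : PMF (firstWindow n)) (P : PMF 𝒳)
    (W : 𝒳 → PMF 𝒴) : PMF (ℤ × (Fin ℓ → 𝒴) × (Fin ℓ → 𝒴)) :=
  (productLaw fun _ : positions n ℓ => P).bind fun x =>
  Q.bind fun i =>
  (secondIndexLaw n ℓ i).bind fun j =>
  (productLaw fun k : Fin ℓ => W (x ⟨(i : ℤ) + (k : ℕ), first_mem_positions i k⟩)).bind fun y₁ =>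
  (productLaw fun k : Fin ℓ => W (x ⟨(j : ℤ) + (k : ℕ), second_mem_positions i j k⟩)).bind fun y₂ =>
  PMF.pure (overlap ℓ i j, y₁, y₂)

/-- The Bayesian error probability of a detector. -/
noncomputable def errorProb (n : ℕ+) (ℓ : ℕ) (Q : PMF (firstWindow n)) (P : PMF 𝒳)
    (W : 𝒳 → PMF 𝒴) (D : Detector ℓ 𝒴) : ℝ :=
  ((readsLaw n ℓ Q P W).toOuterMeasure {ω | (D ω.2.1 ω.2.2 : ℤ) ≠ ω.1}).toReal

/-- The minimal Bayesian error probability over all detectors (an infimum over a nonempty finite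
set of detectors, hence a minimum). -/
noncomputable def optimalErrorProb (n : ℕ+) (ℓ : ℕ) (Q : PMF (firstWindow n)) (P : PMF 𝒳)
    (W : 𝒳 → PMF 𝒴) : ℝ :=
  ⨅ D : Detector ℓ 𝒴, errorProb n ℓ Q P W D

/-- The joint law of two conditionally independent channel outputs of the same input symbol. -/
noncomputable def pairLaw (P : PMF 𝒳) (W : 𝒳 → PMF 𝒴) : PMF (𝒴 × 𝒴) :=
  P.bind fun x => (W x).bind fun y => (W x).bind fun y' => PMF.pure (y, y')

/-- The mutual information, in base `b`, of a pair with joint law `R`. Terms with `R (y, y') = 0`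
vanish; in the other terms the two marginals are positive. -/
noncomputable def mutualInfo (b : ℝ) (R : PMF (𝒴 × 𝒴)) : ℝ :=
  ∑ y, ∑ y', (R (y, y')).toReal *
    Real.logb b ((R (y, y')).toReal /
      (((R.map Prod.fst) y).toReal * ((R.map Prod.snd) y').toReal))

end Model

/-- `min {β, 1 / I}`, with the convention `1 / 0 = ∞`. -/
noncomputable def minInv (β I : ℝ) : ℝ := if I = 0 then β else min β (1 / I)

end OverlapDetection

/-! Two detectors suffice. Given the first index, each shift d = I(2) - I(1) has probability at most
1/n, whatever the law of the first index. Always declaring "no overlap" therefore errs with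
probability at most 2ℓ/n, which yields the term β (`optimalErrorProb_le_two_mul_div`).

For the term 1/I, each shift d is tested through its likelihood ratio `score`, the product of
`density` over the aligned letters, against a threshold b^θ with θ slightly above log n. At the true
shift, the log of the ratio is a sum of i.i.d. terms of mean I, so by Chebyshev the test is passed
with high probability once the overlap is at least τ, a little more than θ/I
(`toOuterMeasure_score_lt_le`). At a wrong shift the ratio has expectation at most 1, although its
factors are dependent: when the aligned pairs are ordered by position, the extreme letter occurs in
one factor only and can be integrated out (`sum_productLaw_mul_prod_le_one`). Markov's inequality
and a union bound over at most 2ℓ shifts then cost 2ℓ/b^θ = o(log n / n). The main term 2τ/n comes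
from the shifts whose overlap is shorter than τ, which are given up.

The probabilistic setting is simplified by `productLaw_bind_reads`: the noisy reads may be taken
from an i.i.d. sequence of pairs (Y, Ỹ), the first read using first components and the second read
second components. -/

namespace OverlapDetection

/-! ### Product laws and the i.i.d. sequence of output pairs -/

theorem productLaw_apply {ι α : Type*} [Fintype ι] [DecidableEq ι] [Fintype α]
    (p : ι → PMF α) (a : ι → α) : productLaw p a = ∏ i, p i (a i) := rfl

/-- Passing independent letters through independent channels. -/
theorem productLaw_bind_productLaw {ι α γ : Type*} [Fintype ι] [DecidableEq ι] [Fintype α]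
    [Fintype γ] (p : ι → PMF α) (V : ι → α → PMF γ) :
    ((productLaw p).bind fun x => productLaw fun i => V i (x i)) =
      productLaw fun i => (p i).bind (V i) := by
  ext y
  simp only [PMF.bind_apply, productLaw_apply, tsum_fintype, ← Finset.prod_mul_distrib]
  rw [Finset.prod_univ_sum, Fintype.piFinset_univ]

/-- Two independent families with independent members, seen as one family of pairs. -/
theorem productLaw_bind_pair {ι α γ δ : Type*} [Fintype ι] [DecidableEq ι] [Fintype α] [Fintype γ]
    (p : ι → PMF α) (q : ι → PMF γ) (F : (ι → α) → (ι → γ) → PMF δ) :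
    ((productLaw p).bind fun a => (productLaw q).bind fun b => F a b) =
      (productLaw fun i => (p i).bind fun a => (q i).bind fun b => PMF.pure (a, b)).bind
        fun z => F (fun i => (z i).1) (fun i => (z i).2) := by
  classical
  have key : (productLaw fun i => (p i).bind fun a => (q i).bind fun b => PMF.pure (a, b)) =
      (productLaw p).bind fun a => (productLaw q).bind fun b => PMF.pure fun i => (a i, b i) := by
    have h1 : ∀ a : ι → α, ((productLaw q).bind fun b => PMF.pure fun i => (a i, b i)) =
        productLaw fun i => (q i).bind fun b => PMF.pure (a i, b) := by
      intro a
      rw [← productLaw_bind_productLaw]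
      congr 1
      ext b z
      rw [productLaw_apply]
      simp only [PMF.pure_apply]
      by_cases h : z = fun i => (a i, b i)
      · simp [h]
      · rw [if_neg h]
        obtain ⟨i, hi⟩ := Function.ne_iff.1 h
        exact (Finset.prod_eq_zero (Finset.mem_univ i) (if_neg hi)).symm
    simp_rw [h1]
    exact (productLaw_bind_productLaw p
      (fun i a => (q i).bind fun b => PMF.pure (a, b))).symm
  rw [key]
  simp [PMF.bind_bind, PMF.pure_bind]

/-- A subfamily of a family of independent variables. -/
theorem productLaw_map_comp {ι κ α : Type*} [Fintype ι] [DecidableEq ι] [Fintype κ]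
    [DecidableEq κ] [Fintype α] (p : ι → PMF α) {e : κ → ι} (he : Function.Injective e) :
    (productLaw p).map (fun a => a ∘ e) = productLaw fun k => p (e k) := by
  classical
  ext b
  -- The event `b = a ∘ e` splits into one condition per coordinate, void outside the range of `e`,
  -- so the sum over `a` factorises.
  have hind : ∀ a : ι → α, (if b = a ∘ e then productLaw p a else 0) =
      ∏ i, if (∀ k, e k = i → a i = b k) then p i (a i) else 0 := by
    intro a
    rw [Fintype.prod_ite_zero, productLaw_apply]
    refine if_congr ⟨?_, ?_⟩ rfl rfl
    · rintro rfl i k rfl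
      rfl
    · intro h
      funext k
      exact (h (e k) k rfl).symm
  rw [PMF.map_apply, tsum_fintype]
  refine (Finset.sum_congr rfl fun a _ => Eq.trans (by congr) (hind a)).trans ?_
  have := Finset.prod_univ_sum (fun _ : ι => (Finset.univ : Finset α))
    (fun i v => if (∀ k, e k = i → v = b k) then p i v else 0)
  rw [Fintype.piFinset_univ] at this
  rw [← this, productLaw_apply]
  have hr : ∀ k, ∑ v, (if (∀ k', e k' = e k → v = b k') then p (e k) v else 0) =
      p (e k) (b k) := by
    intro k
    rw [Finset.sum_eq_single (b k)]
    · rw [if_pos]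
      intro k' hk'
      rw [he hk']
    · intro v _ hv
      rw [if_neg]
      exact fun h => hv (h k rfl)
    · simp
  rw [← Finset.prod_congr rfl fun k _ => hr k,
    ← Finset.prod_image (s := Finset.univ) (g := e)
      (f := fun i => ∑ v, (if (∀ k', e k' = i → v = b k') then p i v else 0)) (he.injOn)]
  symm
  refine Finset.prod_subset (Finset.subset_univ _) fun i _ hi => ?_
  have : ∀ k, e k ≠ i := fun k hk => hi (Finset.mem_image.2 ⟨k, Finset.mem_univ _, hk⟩)
  simp only [this, false_imp_iff, implies_true, if_true]
  rw [← tsum_fintype (L := SummationFilter.unconditional α)]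
  exact (p i).tsum_coe

/-- Noisy reads of a memoryless source are read off a memoryless sequence of pairs of
conditionally independent channel outputs. -/
theorem productLaw_bind_reads {ι κ 𝒳 𝒴 δ : Type*} [Fintype ι] [DecidableEq ι] [Fintype κ]
    [DecidableEq κ] [Fintype 𝒳] [Fintype 𝒴] (P : PMF 𝒳) (W : 𝒳 → PMF 𝒴) {e₁ e₂ : κ → ι}
    (h₁ : Function.Injective e₁) (h₂ : Function.Injective e₂)
    (F : (κ → 𝒴) → (κ → 𝒴) → PMF δ) :
    ((productLaw fun _ : ι => P).bind fun x =>
      (productLaw fun k => W (x (e₁ k))).bind fun y₁ =>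
      (productLaw fun k => W (x (e₂ k))).bind fun y₂ => F y₁ y₂) =
    (productLaw fun _ : ι => pairLaw P W).bind fun z =>
      F (fun k => (z (e₁ k)).1) (fun k => (z (e₂ k)).2) := by
  -- Given the source, the channel is run twice at every position; each read is a subfamily of one
  -- run, and the unused outputs are marginalised away.
  have hx : ∀ x : ι → 𝒳, ((productLaw fun k => W (x (e₁ k))).bind fun y₁ =>
      (productLaw fun k => W (x (e₂ k))).bind fun y₂ => F y₁ y₂) =
      (productLaw fun i => (W (x i)).bind fun y => (W (x i)).bind fun y' => PMF.pure (y, y')).bind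
        fun z => F (fun k => (z (e₁ k)).1) (fun k => (z (e₂ k)).2) := by
    intro x
    rw [← productLaw_map_comp (fun i => W (x i)) h₁, ← productLaw_map_comp (fun i => W (x i)) h₂]
    simp only [PMF.bind_map]
    exact productLaw_bind_pair (fun i => W (x i)) (fun i => W (x i))
      (fun u v => F (u ∘ e₁) (v ∘ e₂))
  simp_rw [hx]
  rw [← PMF.bind_bind]
  congr 1
  exact productLaw_bind_productLaw (fun _ => P)
    (fun _ x => (W x).bind fun y => (W x).bind fun y' => PMF.pure (y, y'))

/-- Expectation under a product law, with one coordinate integrated out. -/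
theorem sum_productLaw_mul_eq_update {ι α : Type*} [Fintype ι] [DecidableEq ι] [Fintype α]
    (p : ι → PMF α) (q : ι) (F : (ι → α) → ENNReal) :
    ∑ z, productLaw p z * F z =
      ∑ z, productLaw p z * ∑ v, p q v * F (Function.update z q v) := by
  -- Swapping coordinate `q` with an independent copy of it preserves the joint law.
  let σ : (ι → α) × α ≃ (ι → α) × α :=
    { toFun := fun w => (Function.update w.1 q w.2, w.1 q)
      invFun := fun w => (Function.update w.1 q w.2, w.1 q)
      left_inv := fun w => by simp
      right_inv := fun w => by simp }
  have hσ : ∀ w : (ι → α) × α, productLaw p w.1 * p q w.2 =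
      productLaw p (σ w).1 * p q (σ w).2 := by
    intro w
    simp only [productLaw_apply, σ, Equiv.coe_fn_mk]
    rw [← Finset.mul_prod_erase _ _ (Finset.mem_univ q),
      ← Finset.mul_prod_erase _ (fun i => p i (Function.update w.1 q w.2 i)) (Finset.mem_univ q),
      Function.update_self, Finset.prod_congr rfl (fun i hi => show
        p i (Function.update w.1 q w.2 i) = p i (w.1 i) by
          rw [Function.update_of_ne (Finset.ne_of_mem_erase hi)])]
    ring
  have hp : ∑ v, p q v = 1 := by
    rw [← tsum_fintype (L := SummationFilter.unconditional α)]
    exact (p q).tsum_coe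
  calc ∑ z, productLaw p z * F z
      = ∑ w : (ι → α) × α, productLaw p w.1 * p q w.2 * F w.1 := by
        rw [Fintype.sum_prod_type]
        refine Finset.sum_congr rfl fun z _ => ?_
        simp only []
        rw [← Finset.sum_mul, ← Finset.mul_sum, hp, mul_one]
    _ = ∑ w : (ι → α) × α, productLaw p (σ w).1 * p q (σ w).2 * F (σ w).1 :=
        (Equiv.sum_comp σ fun w => productLaw p w.1 * p q w.2 * F w.1).symm
    _ = _ := by
        simp_rw [← hσ]
        rw [Fintype.sum_prod_type]
        refine Finset.sum_congr rfl fun z _ => ?_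
        rw [Finset.mul_sum]
        exact Finset.sum_congr rfl fun v _ => mul_assoc _ _ _

/-- A product of ratios over pairs of coordinates without cycles has expectation at most `1`. -/
theorem sum_productLaw_mul_prod_le_one {ι κ α : Type*} [Fintype ι] [DecidableEq ι] [Fintype α]
    [DecidableEq κ] (R : PMF α) (g : α → α → ENNReal) (hg : ∀ u, ∑ v, R v * g u v ≤ 1)
    (key : κ → ℤ) (a b : κ → ι) (S : Finset κ)
    (hab : ∀ q ∈ S, ∀ q' ∈ S, key q' ≤ key q → b q ≠ a q')
    (hbb : ∀ q ∈ S, ∀ q' ∈ S, q ≠ q' → b q ≠ b q') :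
    ∑ z, productLaw (fun _ : ι => R) z * ∏ q ∈ S, g (z (a q)) (z (b q)) ≤ 1 := by
  -- For the pair `m` of largest key, the coordinate `b m` differs from every `a q` and from every
  -- other `b q`, so it enters one factor only; averaging over it removes that factor by `hg`.
  induction S using Finset.induction_on_max_value key with
  | empty =>
    simp only [Finset.prod_empty, mul_one]
    rw [← tsum_fintype (L := SummationFilter.unconditional _)]
    exact (PMF.tsum_coe _).le
  | insert m S hm hmax ih =>
    refine le_trans ?_ (ih (fun q hq q' hq' => hab q (by simp [hq]) q' (by simp [hq']))
      (fun q hq q' hq' => hbb q (by simp [hq]) q' (by simp [hq'])))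
    rw [sum_productLaw_mul_eq_update _ (b m)]
    refine Finset.sum_le_sum fun z _ => ?_
    refine mul_le_mul_right ?_ _
    have hm' : m ∈ insert m S := by simp
    have h1 : ∀ v, R v * ∏ q ∈ insert m S, g (Function.update z (b m) v (a q))
        (Function.update z (b m) v (b q)) =
        (R v * g (z (a m)) v) * ∏ q ∈ S, g (z (a q)) (z (b q)) := by
      intro v
      rw [Finset.prod_insert hm, Function.update_self,
        Function.update_of_ne (hab m hm' m hm' le_rfl).symm, ← mul_assoc]
      congr 1
      refine Finset.prod_congr rfl fun q hq => ?_
      rw [Function.update_of_ne (hab m hm' q (by simp [hq]) (hmax q hq)).symm,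
        Function.update_of_ne]
      exact (hbb m hm' q (by simp [hq]) (fun h => hm (h ▸ hq))).symm
    simp_rw [h1, ← Finset.sum_mul]
    exact mul_le_of_le_one_left' (hg _)

/-! ### Markov and Chebyshev bounds -/

/-- Markov's inequality for a probability mass function on a finite type. -/
theorem toOuterMeasure_le_mul_le {α : Type*} [Fintype α] (p : PMF α) (F : α → ENNReal)
    (A : ENNReal) : p.toOuterMeasure {z | A ≤ F z} * A ≤ ∑ z, p z * F z := by
  classical
  rw [PMF.toOuterMeasure_apply_fintype, Finset.sum_mul]
  refine Finset.sum_le_sum fun z _ => ?_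
  by_cases h : A ≤ F z
  · rw [Set.indicator_of_mem (by exact h)]
    gcongr
  · rw [Set.indicator_of_notMem (by exact h)]
    simp

open MeasureTheory ProbabilityTheory in
theorem productLaw_toMeasure {ι α : Type*} [Fintype ι] [DecidableEq ι] [Fintype α]
    [MeasurableSpace α] [MeasurableSingletonClass α] (p : ι → PMF α) :
    (productLaw p).toMeasure = Measure.pi fun i => (p i).toMeasure := by
  refine Measure.ext_iff_singleton.2 fun a => ?_
  rw [PMF.toMeasure_apply_singleton _ _ (measurableSet_singleton a), productLaw_apply,
    Measure.pi_singleton]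
  exact Finset.prod_congr rfl fun i _ =>
    (PMF.toMeasure_apply_singleton _ _ (measurableSet_singleton _)).symm

/-- The mean of a function under a probability mass function on a finite type. -/
noncomputable def pmfMean {α : Type*} [Fintype α] (R : PMF α) (f : α → ℝ) : ℝ :=
  ∑ a, (R a).toReal * f a

open MeasureTheory ProbabilityTheory in
/-- The weak law of large numbers, with Chebyshev's bound. -/
theorem exists_chebyshev {α : Type*} [Fintype α] (R : PMF α) (f : α → ℝ) :
    ∃ v : ℝ, 0 ≤ v ∧ ∀ {ι : Type} [Fintype ι] [DecidableEq ι] (S : Finset ι) (t : ℝ), 0 < t →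
      (productLaw fun _ : ι => R).toOuterMeasure
        {z | ∑ i ∈ S, f (z i) ≤ S.card * pmfMean R f - t} ≤ ENNReal.ofReal (S.card * v / t ^ 2) := by
  classical
  let _ : MeasurableSpace α := ⊤
  have : DiscreteMeasurableSpace α := ⟨fun _ => trivial⟩
  have hf : MemLp f 2 R.toMeasure := MemLp.of_discrete
  refine ⟨variance f R.toMeasure, variance_nonneg _ _, fun {ι} _ _ S t ht => ?_⟩
  rw [← PMF.toMeasure_apply_eq_toOuterMeasure, productLaw_toMeasure]
  set μ : Measure (ι → α) := Measure.pi fun _ => R.toMeasure with hμ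
  -- Zero outside `S`, so that the variance formula for sums over all coordinates applies.
  let X : ι → α → ℝ := fun i => if i ∈ S then f else 0
  have hX : ∀ i, MemLp (X i) 2 R.toMeasure := fun i => MemLp.of_discrete
  have hsum : ∀ z : ι → α, (∑ i, fun z : ι → α => X i (z i)) z = ∑ i ∈ S, f (z i) := by
    intro z
    simp [X, ite_apply]
  have hvar : variance (∑ i, fun z : ι → α => X i (z i)) μ = S.card * variance f R.toMeasure := by
    rw [variance_sum_pi hX]
    have : ∀ i, variance (X i) R.toMeasure = if i ∈ S then variance f R.toMeasure else 0 := by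
      intro i
      by_cases h : i ∈ S <;> simp [X, h]
    simp [this]
  have hmean : ∫ z, (∑ i, fun z : ι → α => X i (z i)) z ∂μ = S.card * pmfMean R f := by
    have h1 : ∀ i, ∫ z : ι → α, f (z i) ∂μ = pmfMean R f := by
      intro i
      rw [hμ, integral_comp_eval (μ := fun _ : ι => R.toMeasure) hf.aestronglyMeasurable,
        PMF.integral_eq_sum]
      rfl
    simp_rw [hsum]
    rw [integral_finsetSum _ fun i _ => Integrable.of_finite]
    simp [h1]
  have hL : MemLp (∑ i, fun z : ι → α => X i (z i)) 2 μ := MemLp.of_discrete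
  have := meas_ge_le_variance_div_sq hL ht
  rw [hvar, hmean] at this
  refine (measure_mono ?_).trans this
  intro z hz
  simp only [Set.mem_ofPred_eq, hsum] at hz ⊢
  rw [le_abs]
  right
  linarith

/-! ### Likelihood ratio of a letter pair -/

section Density

variable {𝒴 : Type*}

/-- The density of a joint law with respect to the product of its marginals. -/
noncomputable def density (R : PMF (𝒴 × 𝒴)) (w : 𝒴 × 𝒴) : ENNReal :=
  R w / ((R.map Prod.fst) w.1 * (R.map Prod.snd) w.2)

theorem density_ne_zero {R : PMF (𝒴 × 𝒴)} {w : 𝒴 × 𝒴} (hw : R w ≠ 0) : density R w ≠ 0 :=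
  ENNReal.div_ne_zero.2 ⟨hw, ENNReal.mul_ne_top (PMF.apply_ne_top _ _) (PMF.apply_ne_top _ _)⟩

variable [Fintype 𝒴]

theorem map_fst_apply (R : PMF (𝒴 × 𝒴)) (y : 𝒴) : (R.map Prod.fst) y = ∑ y', R (y, y') := by
  classical
  rw [PMF.map_apply, tsum_fintype, Fintype.sum_prod_type, Finset.sum_eq_single y]
  · simp
  · intro b _ hb
    simp [hb.symm]
  · simp

theorem map_snd_apply (R : PMF (𝒴 × 𝒴)) (y' : 𝒴) : (R.map Prod.snd) y' = ∑ y, R (y, y') := by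
  classical
  rw [PMF.map_apply, tsum_fintype, Fintype.sum_prod_type_right, Finset.sum_eq_single y']
  · simp
  · intro b _ hb
    simp [hb.symm]
  · simp

theorem mul_div_mul_le (a p q : ENNReal) (hp : p ≠ ⊤) (hq : q ≠ ⊤) : q * (a / (p * q)) ≤ a / p := by
  rw [div_eq_mul_inv, ENNReal.mul_inv (Or.inr hq) (Or.inl hp), ← mul_assoc a, ← div_eq_mul_inv,
    ← div_eq_mul_inv]
  exact ENNReal.mul_div_le

/-- This is the one-step normalisation needed by `sum_productLaw_mul_prod_le_one`: against an
independent second letter, the ratio integrates to a conditional law. Only an inequality holds,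
since marginals may vanish. -/
theorem sum_mul_density_snd_le_one (R : PMF (𝒴 × 𝒴)) (y : 𝒴) :
    ∑ v, R v * density R (y, v.2) ≤ 1 := by
  rw [Fintype.sum_prod_type_right]
  simp only [← Finset.sum_mul, ← map_snd_apply]
  refine (Finset.sum_le_sum fun y' _ => mul_div_mul_le (R (y, y')) ((R.map Prod.fst) y)
    ((R.map Prod.snd) y') (PMF.apply_ne_top _ _) (PMF.apply_ne_top _ _)).trans ?_
  simp only [div_eq_mul_inv, ← Finset.sum_mul, ← map_fst_apply]
  exact ENNReal.div_self_le_one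

theorem sum_mul_density_fst_le_one (R : PMF (𝒴 × 𝒴)) (y' : 𝒴) :
    ∑ v, R v * density R (v.1, y') ≤ 1 := by
  rw [Fintype.sum_prod_type]
  simp only [← Finset.sum_mul, ← map_fst_apply]
  refine (Finset.sum_le_sum fun y _ => ?_).trans (b := ∑ y, R (y, y') / (R.map Prod.snd) y') ?_
  · have := mul_div_mul_le (R (y, y')) ((R.map Prod.snd) y')
      ((R.map Prod.fst) y) (PMF.apply_ne_top _ _) (PMF.apply_ne_top _ _)
    rwa [mul_comm ((R.map Prod.snd) y')] at this
  simp only [div_eq_mul_inv, ← Finset.sum_mul, ← map_snd_apply]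
  exact ENNReal.div_self_le_one

theorem le_map_fst (R : PMF (𝒴 × 𝒴)) (w : 𝒴 × 𝒴) : R w ≤ (R.map Prod.fst) w.1 := by
  rw [map_fst_apply]
  exact Finset.single_le_sum (f := fun y' => R (w.1, y')) (fun _ _ => zero_le)
    (Finset.mem_univ w.2)

theorem le_map_snd (R : PMF (𝒴 × 𝒴)) (w : 𝒴 × 𝒴) : R w ≤ (R.map Prod.snd) w.2 := by
  rw [map_snd_apply]
  exact Finset.single_le_sum (f := fun y => R (y, w.2)) (fun _ _ => zero_le)
    (Finset.mem_univ w.1)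

theorem density_ne_top {R : PMF (𝒴 × 𝒴)} {w : 𝒴 × 𝒴} (hw : R w ≠ 0) : density R w ≠ ⊤ :=
  ENNReal.div_ne_top (PMF.apply_ne_top _ _) (mul_ne_zero
    (fun h => hw (le_antisymm (h ▸ le_map_fst R w) zero_le))
    (fun h => hw (le_antisymm (h ▸ le_map_snd R w) zero_le)))

/-- The log-likelihood ratio between a joint law and the product of its marginals. -/
noncomputable def logDensity (b : ℝ) (R : PMF (𝒴 × 𝒴)) (w : 𝒴 × 𝒴) : ℝ :=
  Real.logb b (density R w).toReal

theorem mutualInfo_eq_pmfMean (b : ℝ) (R : PMF (𝒴 × 𝒴)) :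
    mutualInfo b R = pmfMean R (logDensity b R) := by
  simp only [mutualInfo, pmfMean, logDensity, density, Fintype.sum_prod_type, ENNReal.toReal_div,
    ENNReal.toReal_mul]

theorem sum_toReal_eq_one {α : Type*} [Fintype α] (p : PMF α) : ∑ a, (p a).toReal = 1 := by
  rw [← ENNReal.toReal_sum fun a _ => p.apply_ne_top a,
    ← tsum_fintype (L := SummationFilter.unconditional α), p.tsum_coe, ENNReal.toReal_one]

/-- Gibbs' inequality: log x ≥ 1 - 1/x is applied termwise, and the lower bounds sum to 1 - 1 = 0.
-/
theorem mutualInfo_nonneg {b : ℝ} (hb : 1 < b) (R : PMF (𝒴 × 𝒴)) : 0 ≤ mutualInfo b R := by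
  have hlog := Real.log_pos hb
  have key : ∀ w : 𝒴 × 𝒴, (R w).toReal -
      ((R.map Prod.fst) w.1).toReal * ((R.map Prod.snd) w.2).toReal ≤
      (R w).toReal * logDensity b R w * Real.log b := by
    intro w
    have hpq : 0 ≤ ((R.map Prod.fst) w.1).toReal * ((R.map Prod.snd) w.2).toReal := by positivity
    by_cases hw : R w = 0
    · simpa [hw] using hpq
    have hR : 0 < (R w).toReal := ENNReal.toReal_pos hw (PMF.apply_ne_top _ _)
    have hD : 0 < (density R w).toReal :=
      ENNReal.toReal_pos (density_ne_zero hw) (density_ne_top hw)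
    rw [logDensity, Real.logb, mul_assoc, div_mul_cancel₀ _ hlog.ne']
    have h1 := Real.one_sub_inv_le_log_of_pos hD
    have h2 : (R w).toReal * (density R w).toReal⁻¹ =
        ((R.map Prod.fst) w.1).toReal * ((R.map Prod.snd) w.2).toReal := by
      rw [density, ENNReal.toReal_div, ENNReal.toReal_mul, inv_div, mul_div_cancel₀ _ hR.ne']
    nlinarith [mul_le_mul_of_nonneg_left h1 hR.le]
  have hs := Finset.sum_le_sum fun w (_ : w ∈ Finset.univ) => key w
  rw [Finset.sum_sub_distrib, sum_toReal_eq_one, Fintype.sum_prod_type, ← Finset.sum_mul] at hs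
  simp only [← Finset.mul_sum, sum_toReal_eq_one, mul_one] at hs
  rw [sub_self, ← pmfMean, ← mutualInfo_eq_pmfMean] at hs
  exact nonneg_of_mul_nonneg_left hs hlog

end Density

/-! ### Likelihood ratio of an alignment -/

section Score

/-- The pairs of read positions that are aligned when the second read starts `d` after the
first. -/
def alignedPairs (ℓ : ℕ) (d : ℤ) : Finset (Fin ℓ × Fin ℓ) :=
  Finset.univ.filter fun q => ((q.1 : ℕ) : ℤ) = (q.2 : ℕ) + d

theorem mem_alignedPairs {ℓ : ℕ} {d : ℤ} {q : Fin ℓ × Fin ℓ} :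
    q ∈ alignedPairs ℓ d ↔ ((q.1 : ℕ) : ℤ) = (q.2 : ℕ) + d := by
  simp [alignedPairs]

theorem le_card_alignedPairs (ℓ : ℕ) (d : ℤ) : (ℓ : ℤ) - |d| ≤ (alignedPairs ℓ d).card := by
  have h : ℓ - d.natAbs ≤ (alignedPairs ℓ d).card := by
    rw [← Fintype.card_fin (ℓ - d.natAbs), ← Finset.card_univ]
    refine Finset.card_le_card_of_injOn
      (fun m : Fin (ℓ - d.natAbs) => (⟨m + d.toNat, ?_⟩, ⟨m + (-d).toNat, ?_⟩)) ?_ ?_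
    · have := m.2; omega
    · have := m.2; omega
    · intro m _
      simp only [Finset.mem_coe, mem_alignedPairs]
      push_cast
      omega
    · intro m _ m' _ h
      simp only [Prod.mk.injEq, Fin.mk.injEq] at h
      ext
      omega
  have := Int.natCast_natAbs d
  omega

variable {𝒴 : Type*} [Fintype 𝒴]

/-- The likelihood ratio of the hypothesis that the second read starts `d` after the first. -/
noncomputable def score {ℓ : ℕ} (R : PMF (𝒴 × 𝒴)) (d : ℤ) (y₁ y₂ : Fin ℓ → 𝒴) : ENNReal :=
  ∏ q ∈ alignedPairs ℓ d, density R (y₁ q.1, y₂ q.2)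

variable {ι : Type} [Fintype ι] [DecidableEq ι] {ℓ : ℕ} {pos : ι → ℤ} {e₁ e₂ : Fin ℓ → ι} {i j : ℤ}

/-- A wrong alignment is unlikely to have a large likelihood ratio. -/
theorem toOuterMeasure_le_score_mul_le (R : PMF (𝒴 × 𝒴))
    (h₁ : ∀ k, pos (e₁ k) = i + (k : ℕ)) (h₂ : ∀ k, pos (e₂ k) = j + (k : ℕ)) {d : ℤ}
    (hd : d ≠ j - i) (A : ENNReal) :
    (productLaw fun _ : ι => R).toOuterMeasure
      {z | A ≤ score R d (fun k => (z (e₁ k)).1) (fun k => (z (e₂ k)).2)} * A ≤ 1 := by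
  refine (toOuterMeasure_le_mul_le (productLaw fun _ : ι => R)
    (fun z => score R d (fun k => (z (e₁ k)).1) (fun k => (z (e₂ k)).2)) A).trans ?_
  simp only [score]
  -- If `d` is below the true shift, the second letter of each aligned pair sits strictly to the
  -- right of the first, so it is the fresh coordinate for the pair of largest key. If `d` is above,
  -- the two reads exchange roles.
  rcases lt_or_gt_of_ne hd with hd | hd
  · have := sum_productLaw_mul_prod_le_one R (fun u v => density R (u.1, v.2))
      (fun u => sum_mul_density_snd_le_one R u.1) (fun q => ((q.1 : ℕ) : ℤ)) (fun q => e₁ q.1)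
      (fun q => e₂ q.2) (alignedPairs ℓ d)
    refine this ?_ ?_
    · intro q hq q' hq' hqq' h
      have := congrArg pos h
      rw [h₁, h₂] at this
      rw [mem_alignedPairs] at hq hq'
      omega
    · intro q hq q' hq' hne h
      have := congrArg pos h
      rw [h₂, h₂] at this
      rw [mem_alignedPairs] at hq hq'
      apply hne
      ext <;> omega
  · have := sum_productLaw_mul_prod_le_one R (fun u v => density R (v.1, u.2))
      (fun u => sum_mul_density_fst_le_one R u.2) (fun q => ((q.1 : ℕ) : ℤ)) (fun q => e₂ q.2)
      (fun q => e₁ q.1) (alignedPairs ℓ d)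
    refine this ?_ ?_
    · intro q hq q' hq' hqq' h
      have := congrArg pos h
      rw [h₁, h₂] at this
      rw [mem_alignedPairs] at hq hq'
      omega
    · intro q hq q' hq' hne h
      have := congrArg pos h
      rw [h₁, h₁] at this
      rw [mem_alignedPairs] at hq hq'
      apply hne
      ext <;> omega

/-- The correct alignment is likely to have a large likelihood ratio. -/
theorem toOuterMeasure_score_lt_le {b : ℝ} (hb : 1 < b) (R : PMF (𝒴 × 𝒴)) {v : ℝ}
    (hv : ∀ {ι : Type} [Fintype ι] [DecidableEq ι] (S : Finset ι) (t : ℝ), 0 < t →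
      (productLaw fun _ : ι => R).toOuterMeasure
        {z | ∑ i ∈ S, logDensity b R (z i) ≤ S.card * mutualInfo b R - t} ≤
          ENNReal.ofReal (S.card * v / t ^ 2))
    (hpos : Function.Injective pos)
    (h₁ : ∀ k, pos (e₁ k) = i + (k : ℕ)) (h₂ : ∀ k, pos (e₂ k) = j + (k : ℕ)) {θ t : ℝ}
    (ht : 0 < t) (hθ : θ ≤ (alignedPairs ℓ (j - i)).card * mutualInfo b R - t) :
    (productLaw fun _ : ι => R).toOuterMeasure
      {z | score R (j - i) (fun k => (z (e₁ k)).1) (fun k => (z (e₂ k)).2) <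
        ENNReal.ofReal (b ^ θ)} ≤
      ENNReal.ofReal ((alignedPairs ℓ (j - i)).card * v / t ^ 2) := by
  -- At the true shift, aligned letters are the two components of the same pair, so the score is a
  -- product of independent densities.
  have he : ∀ q ∈ alignedPairs ℓ (j - i), e₂ q.2 = e₁ q.1 := by
    intro q hq
    apply hpos
    rw [h₁, h₂]
    rw [mem_alignedPairs] at hq
    omega
  have hinj : Set.InjOn (fun q : Fin ℓ × Fin ℓ => e₁ q.1) (alignedPairs ℓ (j - i)) := by
    intro q hq q' hq' h
    have := congrArg pos h
    simp only [h₁] at this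
    rw [Finset.mem_coe, mem_alignedPairs] at hq hq'
    ext <;> omega
  have hcard := Finset.card_image_of_injOn hinj
  have := hv ((alignedPairs ℓ (j - i)).image fun q => e₁ q.1) t ht
  rw [hcard] at this
  refine le_trans (PMF.toOuterMeasure_mono _ ?_) this
  -- Inclusion is needed only on the support, where all densities are positive and finite and
  -- logarithms are legitimate.
  rintro z ⟨hz, hsupp⟩
  have hz0 : ∀ p, R (z p) ≠ 0 := by
    rw [PMF.mem_support_iff, productLaw_apply, Finset.prod_ne_zero_iff] at hsupp
    exact fun p => hsupp p (Finset.mem_univ p)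
  have hscore : score R (j - i) (fun k => (z (e₁ k)).1) (fun k => (z (e₂ k)).2) =
      ∏ p ∈ (alignedPairs ℓ (j - i)).image fun q => e₁ q.1, density R (z p) := by
    rw [Finset.prod_image hinj]
    exact Finset.prod_congr rfl fun q hq => by simp only [he q hq, Prod.mk.eta]
  rw [Set.mem_ofPred_eq, hscore, ENNReal.lt_ofReal_iff_toReal_lt
    (ENNReal.prod_ne_top fun p _ => density_ne_top (hz0 p)), ENNReal.toReal_prod] at hz
  refine le_trans ?_ hθ
  have hD : ∀ p, 0 < (density R (z p)).toReal := fun p =>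
    ENNReal.toReal_pos (density_ne_zero (hz0 p)) (density_ne_top (hz0 p))
  simp only [logDensity]
  rw [← Real.logb_prod _ _ fun p _ => (hD p).ne']
  rw [← Real.logb_lt_iff_lt_rpow hb (Finset.prod_pos fun p _ => hD p)] at hz
  exact hz.le

end Score

/-! ### Shifts, overlaps and the detector -/

/-- Equal window sizes give every admissible shift the same mass 1/n, which makes the error bounds
independent of the law of the first index. -/
theorem card_secondWindow (n : ℕ+) (ℓ : ℕ) (i : ℤ) : (secondWindow n ℓ i).card = n := by
  unfold secondWindow
  split_ifs <;> rw [Int.card_Icc] <;> omega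

theorem secondIndexLaw_apply (n : ℕ+) (ℓ : ℕ) (i : ℤ) (j : secondWindow n ℓ i) :
    secondIndexLaw n ℓ i j = ((n : ℕ) : ENNReal)⁻¹ := by
  have : Nonempty (secondWindow n ℓ i) := (secondWindow_nonempty n ℓ i).to_subtype
  rw [secondIndexLaw, PMF.uniformOfFintype_apply, Fintype.card_coe, card_secondWindow]

theorem overlap_eq (ℓ : ℕ) (i j : ℤ) : overlap ℓ i j = overlap ℓ 0 (j - i) := by
  unfold overlap
  split_ifs <;> omega

theorem overlap_eq_zero {ℓ : ℕ} {d : ℤ} (hd : d ∉ Finset.Ioo (-(ℓ : ℤ)) ℓ) :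
    overlap ℓ 0 d = 0 := by
  rw [Finset.mem_Ioo] at hd
  unfold overlap
  split_ifs <;> omega

theorem overlap_mem_overlapSet {ℓ : ℕ} {d : ℤ} (hd : d ∈ Finset.Ioo (-(ℓ : ℤ)) ℓ) :
    overlap ℓ 0 d ∈ overlapSet ℓ := by
  rw [Finset.mem_Ioo] at hd
  unfold overlap overlapSet
  rw [Set.mem_ofPred_eq]
  split_ifs <;> omega

variable {𝒳 𝒴 : Type*}

/-- The position of the `k`-th letter of the first read. -/
noncomputable def firstPos {n : ℕ+} {ℓ : ℕ} (i : firstWindow n) (k : Fin ℓ) : positions n ℓ :=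
  ⟨(i : ℤ) + (k : ℕ), first_mem_positions i k⟩

/-- The position of the `k`-th letter of the second read. -/
noncomputable def secondPos {n : ℕ+} {ℓ : ℕ} (i : firstWindow n) (j : secondWindow n ℓ (i : ℤ))
    (k : Fin ℓ) : positions n ℓ :=
  ⟨(j : ℤ) + (k : ℕ), second_mem_positions i j k⟩

theorem firstPos_injective {n : ℕ+} {ℓ : ℕ} (i : firstWindow n) :
    Function.Injective (firstPos (ℓ := ℓ) i) := by
  intro k k' h
  have := congrArg Subtype.val h
  simp only [firstPos] at this
  ext
  omega

theorem secondPos_injective {n : ℕ+} {ℓ : ℕ} (i : firstWindow n) (j : secondWindow n ℓ (i : ℤ)) :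
    Function.Injective (secondPos i j) := by
  intro k k' h
  have := congrArg Subtype.val h
  simp only [secondPos] at this
  ext
  omega

/-- The detector that looks for an alignment of at least `τ` letters whose likelihood ratio is at
least `A`, and otherwise declares that there is no overlap. -/
noncomputable def scoreDetector (R : PMF (𝒴 × 𝒴)) (ℓ τ : ℕ) (A : ENNReal) : Detector ℓ 𝒴 :=
  open Classical in fun y₁ y₂ =>
    if h : ∃ d ∈ Finset.Ioo (-(ℓ : ℤ)) ℓ, (τ : ℤ) ≤ ℓ - |d| ∧ A ≤ score R d y₁ y₂ then
      ⟨overlap ℓ 0 h.choose, overlap_mem_overlapSet h.choose_spec.1⟩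
    else ⟨0, Or.inr (Or.inl rfl)⟩

/-- An error has two causes. Either the chosen shift is wrong and passed the test, or none was
chosen although the true one overlaps, so that one failed the test or had an overlap below `τ`. -/
theorem scoreDetector_ne {R : PMF (𝒴 × 𝒴)} {ℓ τ : ℕ} {A : ENNReal} {y₁ y₂ : Fin ℓ → 𝒴} {d₀ : ℤ}
    (h : (scoreDetector R ℓ τ A y₁ y₂ : ℤ) ≠ overlap ℓ 0 d₀) :
    (∃ d ∈ Finset.Ioo (-(ℓ : ℤ)) ℓ, d ≠ d₀ ∧ A ≤ score R d y₁ y₂) ∨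
      (d₀ ∈ Finset.Ioo (-(ℓ : ℤ)) ℓ ∧ ((τ : ℤ) ≤ ℓ - |d₀| → score R d₀ y₁ y₂ < A)) := by
  unfold scoreDetector at h
  split_ifs at h with hex
  · refine Or.inl ⟨hex.choose, hex.choose_spec.1, ?_, hex.choose_spec.2.2⟩
    rintro heq
    exact h (congrArg (overlap ℓ 0) heq)
  · refine Or.inr ⟨?_, fun hτ => ?_⟩
    · by_contra hd
      exact h (overlap_eq_zero hd).symm
    · by_contra hs
      by_cases hd : d₀ ∈ Finset.Ioo (-(ℓ : ℤ)) ℓ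
      · exact hex ⟨d₀, hd, hτ, not_lt.1 hs⟩
      · exact h (overlap_eq_zero hd).symm

/-! ### Error bounds for fixed n -/

variable [Fintype 𝒳] [Fintype 𝒴]

/-- The indices are independent of the source, so they can be drawn first; for fixed indices the
reads come from the sequence of pairs. -/
theorem readsLaw_eq (n : ℕ+) (ℓ : ℕ) (Q : PMF (firstWindow n)) (P : PMF 𝒳) (W : 𝒳 → PMF 𝒴) :
    readsLaw n ℓ Q P W = Q.bind fun i => (secondIndexLaw n ℓ i).bind fun j =>
      (productLaw fun _ : positions n ℓ => pairLaw P W).map fun z =>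
        (overlap ℓ i j, (fun k => (z (firstPos i k)).1), fun k => (z (secondPos i j k)).2) := by
  unfold readsLaw
  rw [PMF.bind_comm]
  congr 1
  funext i
  rw [PMF.bind_comm]
  congr 1
  funext j
  exact productLaw_bind_reads P W (firstPos_injective i) (secondPos_injective i j)
    (fun y₁ y₂ => PMF.pure (overlap ℓ i j, y₁, y₂))

/-- A bound for the error probability in terms of the conditional error probabilities given the
two starting indices. -/
theorem toOuterMeasure_readsLaw_le (n : ℕ+) (ℓ : ℕ) (Q : PMF (firstWindow n)) (P : PMF 𝒳)
    (W : 𝒳 → PMF 𝒴) (D : Detector ℓ 𝒴) (a : ℤ → ENNReal) (c : ENNReal)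
    (h : ∀ (i : firstWindow n) (j : secondWindow n ℓ (i : ℤ)),
      (productLaw fun _ : positions n ℓ => pairLaw P W).toOuterMeasure
        {z | (D (fun k => (z (firstPos i k)).1) (fun k => (z (secondPos i j k)).2) : ℤ) ≠
          overlap ℓ 0 (j - i)} ≤
        (if (j : ℤ) - i ∈ Finset.Ioo (-(ℓ : ℤ)) ℓ then a (j - i) else 0) + c) :
    (readsLaw n ℓ Q P W).toOuterMeasure {ω | (D ω.2.1 ω.2.2 : ℤ) ≠ ω.1} ≤
      ((n : ℕ) : ENNReal)⁻¹ * ∑ d ∈ Finset.Ioo (-(ℓ : ℤ)) ℓ, a d + c := by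
  have hn : ((n : ℕ) : ENNReal)⁻¹ * (n : ℕ) = 1 :=
    ENNReal.inv_mul_cancel (by simp) (ENNReal.natCast_ne_top _)
  rw [readsLaw_eq, PMF.toOuterMeasure_bind_apply]
  refine le_trans (ENNReal.tsum_le_tsum fun i => mul_le_mul_right (?_ :
    _ ≤ ((n : ℕ) : ENNReal)⁻¹ * ∑ d ∈ Finset.Ioo (-(ℓ : ℤ)) ℓ, a d + c) (Q i)) ?_
  · rw [PMF.toOuterMeasure_bind_apply, tsum_fintype]
    simp only [secondIndexLaw_apply, PMF.toOuterMeasure_map_apply]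
    have h' : ∀ j : secondWindow n ℓ (i : ℤ), (productLaw fun _ : positions n ℓ =>
        pairLaw P W).toOuterMeasure ((fun z => (overlap ℓ i j, (fun k => (z (firstPos i k)).1),
          fun k => (z (secondPos i j k)).2)) ⁻¹' {ω | (D ω.2.1 ω.2.2 : ℤ) ≠ ω.1}) ≤
        (if (j : ℤ) - i ∈ Finset.Ioo (-(ℓ : ℤ)) ℓ then a (j - i) else 0) + c := by
      intro j
      refine le_trans (le_of_eq ?_) (h i j)
      rw [← overlap_eq]
      rfl
    rw [← Finset.mul_sum]
    refine (mul_le_mul_right (Finset.sum_le_sum fun j _ => h' j) _).trans ?_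
    rw [Finset.sum_add_distrib, mul_add, Finset.sum_const, Finset.card_univ, Fintype.card_coe,
      card_secondWindow, nsmul_eq_mul, ← mul_assoc, hn, one_mul]
    gcongr
    -- The map `j ↦ j - i` is injective, so the sum over the window is at most the sum over all
    -- shifts.
    rw [Finset.univ_eq_attach, Finset.sum_attach (secondWindow n ℓ i)
      (fun j => if j - (i : ℤ) ∈ Finset.Ioo (-(ℓ : ℤ)) ℓ then a (j - i) else 0),
      ← Finset.sum_filter, ← Finset.sum_image (g := fun j => j - (i : ℤ)) (f := a)
        (fun x _ y _ hxy => by simpa using hxy)]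
    refine Finset.sum_le_sum_of_subset fun d hd => ?_
    obtain ⟨j, hj, rfl⟩ := Finset.mem_image.1 hd
    exact (Finset.mem_filter.1 hj).2
  · rw [ENNReal.tsum_mul_right, Q.tsum_coe, one_mul]

theorem toOuterMeasure_le_one {α : Type*} (p : PMF α) (s : Set α) : p.toOuterMeasure s ≤ 1 := by
  refine (MeasureTheory.measure_mono (Set.subset_univ s)).trans (le_of_eq ?_)
  rw [PMF.toOuterMeasure_apply_eq_one_iff]
  exact Set.subset_univ _

theorem toOuterMeasure_scoreDetector_le {n : ℕ+} {ℓ τ : ℕ} (R : PMF (𝒴 × 𝒴)) {b θ r v : ℝ}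
    (hb : 1 < b) (hr : 0 < r) (hI : 0 < mutualInfo b R) (hτ0 : 0 < τ) (hv0 : 0 ≤ v)
    (hθ : θ ≤ τ * mutualInfo b R * (1 - r)) (hr1 : r < 1)
    (hv : ∀ {ι : Type} [Fintype ι] [DecidableEq ι] (S : Finset ι) (t : ℝ), 0 < t →
      (productLaw fun _ : ι => R).toOuterMeasure
        {z | ∑ i ∈ S, logDensity b R (z i) ≤ S.card * mutualInfo b R - t} ≤
          ENNReal.ofReal (S.card * v / t ^ 2))
    (i : firstWindow n) (j : secondWindow n ℓ (i : ℤ)) :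
    (productLaw fun _ : positions n ℓ => R).toOuterMeasure
      {z | (scoreDetector R ℓ τ (ENNReal.ofReal (b ^ θ)) (fun k => (z (firstPos i k)).1)
        (fun k => (z (secondPos i j k)).2) : ℤ) ≠ overlap ℓ 0 (j - i)} ≤
      (if (j : ℤ) - i ∈ Finset.Ioo (-(ℓ : ℤ)) ℓ then
        (if (τ : ℤ) ≤ ℓ - |(j : ℤ) - i| then
          ENNReal.ofReal (v / (τ * (mutualInfo b R * r) ^ 2)) else 1) else 0) +
      ENNReal.ofReal (2 * ℓ / b ^ θ) := by
  classical
  set A := ENNReal.ofReal (b ^ θ) with hA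
  have hbθ : 0 < b ^ θ := Real.rpow_pos_of_pos (by linarith) θ
  have h₁ : ∀ k, ((firstPos i k : positions n ℓ) : ℤ) = i + (k : Fin ℓ) := fun k => rfl
  have h₂ : ∀ k, ((secondPos i j k : positions n ℓ) : ℤ) = j + (k : Fin ℓ) := fun k => rfl
  let M := (productLaw fun _ : positions n ℓ => R).toOuterMeasure
  let E : ℤ → Set (positions n ℓ → 𝒴 × 𝒴) := fun d =>
    {z | A ≤ score R d (fun k => (z (firstPos i k)).1) (fun k => (z (secondPos i j k)).2)}
  let S := (Finset.Ioo (-(ℓ : ℤ)) ℓ).filter (· ≠ (j : ℤ) - i)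
  let G : Set (positions n ℓ → 𝒴 × 𝒴) := {z | (j : ℤ) - i ∈ Finset.Ioo (-(ℓ : ℤ)) ℓ ∧
    ((τ : ℤ) ≤ ℓ - |(j : ℤ) - i| → score R ((j : ℤ) - i) (fun k => (z (firstPos i k)).1)
      (fun k => (z (secondPos i j k)).2) < A)}
  have hsub : {z | (scoreDetector R ℓ τ A (fun k => (z (firstPos i k)).1)
      (fun k => (z (secondPos i j k)).2) : ℤ) ≠ overlap ℓ 0 (j - i)} ⊆ G ∪ ⋃ d ∈ S, E d := by
    intro z hz
    rcases scoreDetector_ne hz with ⟨d, hd, hne, hs⟩ | hG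
    · exact Or.inr (Set.mem_biUnion (Finset.mem_filter.2 ⟨hd, hne⟩) hs)
    · exact Or.inl hG
  refine (MeasureTheory.measure_mono hsub).trans ((MeasureTheory.measure_union_le _ _).trans (add_le_add ?_ ?_))
  · split_ifs with hd hτ
    · refine (MeasureTheory.measure_mono (fun z hz => hz.2 hτ : G ⊆ {z | score R ((j : ℤ) - i)
        (fun k => (z (firstPos i k)).1) (fun k => (z (secondPos i j k)).2) < A})).trans ?_
      set m := (alignedPairs ℓ ((j : ℤ) - i)).card with hm
      have hmτ : (τ : ℝ) ≤ m := by
        have := le_card_alignedPairs ℓ ((j : ℤ) - i)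
        exact_mod_cast hτ.trans this
      have hτ' : (0 : ℝ) < τ := by exact_mod_cast hτ0
      have hm0 : (0 : ℝ) < m := hτ'.trans_le hmτ
      -- The allowed deviation is a fraction `r` of the mean, so Chebyshev's bound decreases in `m`
      -- and may be evaluated at `τ`.
      refine (toOuterMeasure_score_lt_le (t := m * (mutualInfo b R * r)) hb R hv
        Subtype.val_injective h₁ h₂ (by positivity) ?_).trans ?_
      · rw [← hm]
        have : τ * mutualInfo b R * (1 - r) ≤ m * mutualInfo b R * (1 - r) := by
          gcongr
        linarith
      · refine ENNReal.ofReal_le_ofReal ?_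
        rw [← hm]
        have : (m : ℝ) * v / (m * (mutualInfo b R * r)) ^ 2 =
            v / (m * (mutualInfo b R * r) ^ 2) := by
          field_simp
        rw [this]
        gcongr
    · exact toOuterMeasure_le_one _ _
    · refine (MeasureTheory.measure_mono (fun z hz => hd hz.1 : G ⊆ ∅)).trans ?_
      exact (MeasureTheory.measure_empty (μ := M)).trans_le zero_le
  · refine (MeasureTheory.measure_biUnion_finset_le S E).trans ?_
    have hE : ∀ d ∈ S, M (E d) ≤ A⁻¹ := by
      intro d hd
      rw [ENNReal.le_inv_iff_mul_le]
      exact toOuterMeasure_le_score_mul_le (pos := Subtype.val) R h₁ h₂ (Finset.mem_filter.1 hd).2 A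
    refine (Finset.sum_le_card_nsmul S _ _ hE).trans ?_
    rw [nsmul_eq_mul, hA, ← ENNReal.ofReal_inv_of_pos hbθ, ← ENNReal.ofReal_natCast,
      ← ENNReal.ofReal_mul (by positivity), div_eq_mul_inv]
    refine ENNReal.ofReal_le_ofReal ?_
    gcongr
    have h3 : S.card ≤ (Finset.Ioo (-(ℓ : ℤ)) ℓ).card := Finset.card_filter_le _ _
    rw [Int.card_Ioo] at h3
    have : S.card ≤ 2 * ℓ := by omega
    exact_mod_cast this

theorem optimalErrorProb_le (n : ℕ+) (ℓ : ℕ) (Q : PMF (firstWindow n)) (P : PMF 𝒳)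
    (W : 𝒳 → PMF 𝒴) (D : Detector ℓ 𝒴) {x : ℝ} (hx : 0 ≤ x)
    (h : (readsLaw n ℓ Q P W).toOuterMeasure {ω | (D ω.2.1 ω.2.2 : ℤ) ≠ ω.1} ≤ ENNReal.ofReal x) :
    optimalErrorProb n ℓ Q P W ≤ x :=
  (ciInf_le ⟨0, by rintro _ ⟨D, rfl⟩; exact ENNReal.toReal_nonneg⟩ D).trans
    (ENNReal.toReal_le_of_le_ofReal hx h)

/-- Declaring that there is no overlap. -/
theorem optimalErrorProb_le_two_mul_div (n : ℕ+) (ℓ : ℕ) (Q : PMF (firstWindow n)) (P : PMF 𝒳)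
    (W : 𝒳 → PMF 𝒴) : optimalErrorProb n ℓ Q P W ≤ 2 * ℓ / n := by
  refine optimalErrorProb_le n ℓ Q P W (fun _ _ => ⟨0, Or.inr (Or.inl rfl)⟩) (by positivity) ?_
  refine (toOuterMeasure_readsLaw_le n ℓ Q P W (fun _ _ => ⟨0, Or.inr (Or.inl rfl)⟩) 1 0 fun i j => ?_).trans ?_
  · split_ifs with hd
    · rw [Pi.one_apply, add_zero]
      exact toOuterMeasure_le_one _ _
    · simp [overlap_eq_zero hd]
  · have hn : (0 : ℝ) < (n : ℕ) := by exact_mod_cast n.pos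
    simp only [Pi.one_apply, Finset.sum_const, add_zero, nsmul_eq_mul, mul_one]
    rw [← ENNReal.ofReal_natCast, ← ENNReal.ofReal_natCast, ← ENNReal.ofReal_inv_of_pos hn,
      ← ENNReal.ofReal_mul (by positivity), div_eq_inv_mul]
    refine ENNReal.ofReal_le_ofReal ?_
    gcongr
    have : (Finset.Ioo (-(ℓ : ℤ)) ℓ).card ≤ 2 * ℓ := by
      rw [Int.card_Ioo]
      omega
    exact_mod_cast this

theorem card_filter_lt_le (ℓ τ : ℕ) :
    ((Finset.Ioo (-(ℓ : ℤ)) ℓ).filter fun d => ¬ (τ : ℤ) ≤ ℓ - |d|).card ≤ 2 * τ := by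
  have : ((Finset.Ioo (-(ℓ : ℤ)) ℓ).filter fun d => ¬ (τ : ℤ) ≤ ℓ - |d|) ⊆
      Finset.Ioo (-(ℓ : ℤ)) (τ - ℓ) ∪ Finset.Ioo ((ℓ : ℤ) - τ) ℓ := by
    intro d hd
    simp only [Finset.mem_filter, Finset.mem_union, Finset.mem_Ioo] at hd ⊢
    rcases abs_cases d with h | h <;> omega
  refine (Finset.card_le_card this).trans ((Finset.card_union_le _ _).trans ?_)
  rw [Int.card_Ioo, Int.card_Ioo]
  omega

/-- Short overlaps cost 1 for each of at most 2τ shifts, and missed long overlaps cost the Chebyshev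
bound for each of at most 2ℓ shifts; both are weighted by 1/n. False alignments carry no such
weight, hence the need for b^θ to exceed n. -/
theorem optimalErrorProb_le_of_score (n : ℕ+) (ℓ : ℕ) {τ : ℕ} (Q : PMF (firstWindow n)) (P : PMF 𝒳)
    (W : 𝒳 → PMF 𝒴) {b θ r v : ℝ}
    (hb : 1 < b) (hr : 0 < r) (hI : 0 < mutualInfo b (pairLaw P W)) (hτ0 : 0 < τ) (hv0 : 0 ≤ v)
    (hθ : θ ≤ τ * mutualInfo b (pairLaw P W) * (1 - r)) (hr1 : r < 1)
    (hv : ∀ {ι : Type} [Fintype ι] [DecidableEq ι] (S : Finset ι) (t : ℝ), 0 < t →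
      (productLaw fun _ : ι => pairLaw P W).toOuterMeasure
        {z | ∑ i ∈ S, logDensity b (pairLaw P W) (z i) ≤
          S.card * mutualInfo b (pairLaw P W) - t} ≤ ENNReal.ofReal (S.card * v / t ^ 2)) :
    optimalErrorProb n ℓ Q P W ≤
      (2 * τ + 2 * ℓ * (v / (τ * (mutualInfo b (pairLaw P W) * r) ^ 2))) / n +
        2 * ℓ / b ^ θ := by
  set η := v / (τ * (mutualInfo b (pairLaw P W) * r) ^ 2) with hη
  have hη0 : 0 ≤ η := by positivity
  have hbθ : 0 < b ^ θ := Real.rpow_pos_of_pos (by linarith) θ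
  have hn : (0 : ℝ) < (n : ℕ) := by exact_mod_cast n.pos
  refine optimalErrorProb_le n ℓ Q P W
    (scoreDetector (pairLaw P W) ℓ τ (ENNReal.ofReal (b ^ θ))) (by positivity) ?_
  refine (toOuterMeasure_readsLaw_le n ℓ Q P W _
    (fun d => if (τ : ℤ) ≤ ℓ - |d| then ENNReal.ofReal η else 1) (ENNReal.ofReal (2 * ℓ / b ^ θ))
    (toOuterMeasure_scoreDetector_le (pairLaw P W) hb hr hI hτ0 hv0 hθ hr1 hv)).trans ?_
  rw [ENNReal.ofReal_add (by positivity) (by positivity)]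
  gcongr
  have h1 : ∀ d : ℤ, (if (τ : ℤ) ≤ ℓ - |d| then ENNReal.ofReal η else 1) =
      ENNReal.ofReal (if (τ : ℤ) ≤ ℓ - |d| then η else 1) := by
    intro d
    split_ifs <;> simp
  simp only [h1]
  rw [← ENNReal.ofReal_sum_of_nonneg (fun d _ => by split_ifs <;> positivity),
    ← ENNReal.ofReal_natCast, ← ENNReal.ofReal_inv_of_pos hn, ← ENNReal.ofReal_mul (by positivity),
    div_eq_inv_mul]
  refine ENNReal.ofReal_le_ofReal ?_
  gcongr
  rw [Finset.sum_ite, Finset.sum_const, Finset.sum_const, nsmul_eq_mul, nsmul_eq_mul, mul_one,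
    add_comm]
  have h2 : (Finset.Ioo (-(ℓ : ℤ)) ℓ).card ≤ 2 * ℓ := by
    rw [Int.card_Ioo]
    omega
  gcongr
  · exact_mod_cast card_filter_lt_le ℓ τ
  · exact_mod_cast (Finset.card_filter_le _ _).trans h2

/-! ### Asymptotics -/

theorem tendsto_logb_pnat {b : ℝ} (hb : 1 < b) :
    Tendsto (fun n : ℕ+ => Real.logb b (n : ℝ)) atTop atTop := by
  exact (Real.tendsto_logb_atTop hb).comp
    (tendsto_natCast_atTop_atTop.comp tendsto_PNat_val_atTop_atTop)

/-- A uniform asymptotic upper bound with an arbitrarily small loss is one with a vanishing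
loss. -/
theorem exists_tendsto_zero_of_forall_eventually_le {α : Type*} [Preorder α] {κ : α → Type*}
    [∀ n, Nonempty (κ n)] (f : ∀ n, κ n → ℝ) (g : α → ℝ) (hg : ∀ᶠ n in atTop, 0 < g n)
    (h : ∀ δ : ℝ, 0 < δ → ∀ᶠ n in atTop, ∀ Q, f n Q ≤ (1 + δ) * g n) :
    ∃ ε : α → ℝ, Tendsto ε atTop (𝓝 0) ∧ ∀ᶠ n in atTop, ∀ Q, f n Q ≤ (1 + ε n) * g n := by
  -- The least admissible loss, uniform in `Q`, serves as ε: it is eventually below any given δ, and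
  -- it is itself admissible because the bound is a closed condition on δ.
  let s : α → Set ℝ := fun n => {δ | 0 ≤ δ ∧ ∀ Q, f n Q ≤ (1 + δ) * g n}
  have hs : ∀ n, ∀ δ ∈ s n, 0 ≤ δ := fun n δ hδ => hδ.1
  refine ⟨fun n => sInf (s n), ?_, ?_⟩
  · rw [tendsto_order]
    refine ⟨fun a ha => Eventually.of_forall fun n => ha.trans_le (Real.sInf_nonneg (hs n)),
      fun a ha => ?_⟩
    filter_upwards [h (a / 2) (by linarith)] with n hn
    exact (csInf_le ⟨0, hs n⟩ ⟨by linarith, hn⟩).trans_lt (by linarith)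
  · filter_upwards [hg, h 1 one_pos] with n hn h1 Q
    have : f n Q / g n - 1 ≤ sInf (s n) := by
      refine le_csInf ⟨1, zero_le_one, h1⟩ fun δ hδ => ?_
      have := (div_le_iff₀ hn).2 (hδ.2 Q)
      linarith
    rw [← div_le_iff₀ hn]
    linarith

theorem eventually_optimalErrorProb_le_of_length (P : PMF 𝒳) (W : 𝒳 → PMF 𝒴) {b β δ : ℝ}
    (hb : 1 < b) (hβ : 0 < β) (hδ : 0 < δ) (ℓ : ℕ+ → ℕ)
    (hℓ : Tendsto (fun n : ℕ+ => (ℓ n : ℝ) / Real.logb b (n : ℝ)) atTop (𝓝 β)) :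
    ∀ᶠ n : ℕ+ in atTop, ∀ Q : PMF (firstWindow n), optimalErrorProb n (ℓ n) Q P W ≤
      (1 + δ) * (2 * β * (Real.logb b (n : ℝ) / n)) := by
  filter_upwards [(tendsto_logb_pnat hb).eventually_gt_atTop 0,
    hℓ.eventually_lt_const (by nlinarith : β < (1 + δ) * β)] with n hn h Q
  refine (optimalErrorProb_le_two_mul_div n (ℓ n) Q P W).trans ?_
  rw [div_lt_iff₀ hn] at h
  have hn0 : (0 : ℝ) < (n : ℕ) := by exact_mod_cast n.pos
  rw [div_le_iff₀ hn0]
  field_simp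
  linarith

/-- Take τ ≈ (1 + δ/2) log n / I and θ = (1 + δ/4) log n. Short overlaps give the main term, misses
are O(1/n), and false alignments cost 2ℓ/n^(1 + δ/4). It is harmless if τ exceeds ℓ. -/
theorem eventually_optimalErrorProb_le_of_mutualInfo (P : PMF 𝒳) (W : 𝒳 → PMF 𝒴) {b β δ : ℝ}
    (hb : 1 < b) (hδ : 0 < δ) (hI : 0 < mutualInfo b (pairLaw P W)) (ℓ : ℕ+ → ℕ)
    (hℓ : Tendsto (fun n : ℕ+ => (ℓ n : ℝ) / Real.logb b (n : ℝ)) atTop (𝓝 β)) :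
    ∀ᶠ n : ℕ+ in atTop, ∀ Q : PMF (firstWindow n), optimalErrorProb n (ℓ n) Q P W ≤
      (1 + δ) * (2 * (1 / mutualInfo b (pairLaw P W)) * (Real.logb b (n : ℝ) / n)) := by
  obtain ⟨v, hv0, hv⟩ := exists_chebyshev (pairLaw P W) (logDensity b (pairLaw P W))
  rw [← mutualInfo_eq_pmfMean] at hv
  set I := mutualInfo b (pairLaw P W) with hIdef
  -- Chosen so that (1 + δ/2)(1 - r) = 1 + δ/4, which makes the lowered mean reach θ.
  set r := 1 - (1 + δ / 4) / (1 + δ / 2) with hr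
  have hr1 : r < 1 := by
    have : 0 < (1 + δ / 4) / (1 + δ / 2) := by positivity
    linarith
  have hr0 : 0 < r := by
    rw [hr, sub_pos, div_lt_one (by positivity)]
    linarith
  have hlog := tendsto_logb_pnat hb
  have hexp : Tendsto (fun n : ℕ+ => (b ^ (δ / 4 * Real.logb b (n : ℝ)))⁻¹) atTop (𝓝 0) :=
    ((tendsto_rpow_atTop_of_base_gt_one b hb).comp
      (hlog.const_mul_atTop (by positivity : 0 < δ / 4))).inv_tendsto_atTop
  -- This is an upper bound for the error divided by log n / n; the second summand absorbs the
  -- rounding of `τ`.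
  have hlim : Tendsto (fun n : ℕ+ => 2 * ((1 + δ / 2) / I) + 2 * (Real.logb b (n : ℝ))⁻¹ +
      2 * ((ℓ n : ℝ) / Real.logb b (n : ℝ)) *
        (v / ((1 + δ / 2) / I * (I * r) ^ 2) * (Real.logb b (n : ℝ))⁻¹ +
          (b ^ (δ / 4 * Real.logb b (n : ℝ)))⁻¹)) atTop (𝓝 (2 * ((1 + δ / 2) / I))) := by
    have h1 := hlog.inv_tendsto_atTop
    have := ((tendsto_const_nhds (x := 2 * ((1 + δ / 2) / I))).add (h1.const_mul 2)).add
      ((hℓ.const_mul 2).mul ((h1.const_mul (v / ((1 + δ / 2) / I * (I * r) ^ 2))).add hexp))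
    simpa using this
  have hlt : 2 * ((1 + δ / 2) / I) < 2 * ((1 + δ) / I) := by
    gcongr
    linarith
  filter_upwards [hlog.eventually_gt_atTop 0, hlim.eventually_lt_const hlt] with n hn h Q
  set x := Real.logb b (n : ℝ) with hx
  have hn0 : (0 : ℝ) < (n : ℕ) := by exact_mod_cast n.pos
  set τ := ⌈(1 + δ / 2) / I * x⌉₊ with hτ
  have hy0 : 0 < (1 + δ / 2) / I * x := by positivity
  have hτ1 : (1 + δ / 2) / I * x ≤ τ := Nat.le_ceil _
  have hτ2 : (τ : ℝ) ≤ (1 + δ / 2) / I * x + 1 := (Nat.ceil_lt_add_one hy0.le).le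
  have hτ0 : 0 < τ := Nat.ceil_pos.2 hy0
  have hθ : (1 + δ / 4) * x ≤ τ * I * (1 - r) := by
    have h2 : (1 + δ / 4) * x = (1 + δ / 2) / I * x * I * (1 - r) := by
      rw [hr]
      field_simp
      ring
    rw [h2]
    have : 0 ≤ 1 - r := by linarith
    gcongr
  refine (optimalErrorProb_le_of_score n (ℓ n) Q P W hb hr0 hI hτ0 hv0 hθ hr1 hv).trans ?_
  have hpow : b ^ ((1 + δ / 4) * x) = n * b ^ (δ / 4 * x) := by
    rw [add_mul, one_mul, Real.rpow_add (by linarith), hx,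
      Real.rpow_logb (by linarith) hb.ne' hn0]
  have hη : v / (τ * (I * r) ^ 2) ≤ v / ((1 + δ / 2) / I * (I * r) ^ 2) * x⁻¹ := by
    calc v / (τ * (I * r) ^ 2) ≤ v / ((1 + δ / 2) / I * x * (I * r) ^ 2) := by gcongr
      _ = _ := by field_simp
  rw [hpow]
  calc (2 * τ + 2 * ℓ n * (v / (τ * (I * r) ^ 2))) / n + 2 * ℓ n / (n * b ^ (δ / 4 * x))
      = (2 * τ + 2 * ℓ n * (v / (τ * (I * r) ^ 2) + (b ^ (δ / 4 * x))⁻¹)) / n := by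
        field_simp
        ring
    _ ≤ (2 * ((1 + δ / 2) / I * x + 1) + 2 * ℓ n *
        (v / ((1 + δ / 2) / I * (I * r) ^ 2) * x⁻¹ + (b ^ (δ / 4 * x))⁻¹)) / n := by
        gcongr
    _ = (2 * ((1 + δ / 2) / I) + 2 * x⁻¹ + 2 * (ℓ n / x) *
        (v / ((1 + δ / 2) / I * (I * r) ^ 2) * x⁻¹ + (b ^ (δ / 4 * x))⁻¹)) * (x / n) := by
        generalize (b ^ (δ / 4 * x))⁻¹ = B
        generalize v / ((1 + δ / 2) / I * (I * r) ^ 2) = K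
        field_simp
    _ ≤ 2 * ((1 + δ) / I) * (x / n) := by gcongr
    _ = _ := by ring

end OverlapDetection

theorem mainTheorem3 {𝒳 𝒴 : Type*} [Fintype 𝒳] [Nontrivial 𝒳] [Fintype 𝒴]
    (P : PMF 𝒳) (W : 𝒳 → PMF 𝒴) (β : ℝ) (hβ : 0 < β) (ℓ : ℕ+ → ℕ)
    (hℓ : Tendsto (fun n : ℕ+ => (ℓ n : ℝ) / Real.logb (Fintype.card 𝒳) (n : ℝ)) atTop (𝓝 β)) :
    ∃ ε : ℕ+ → ℝ, Tendsto ε atTop (𝓝 0) ∧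
      ∀ᶠ n : ℕ+ in atTop, ∀ Q : PMF (OverlapDetection.firstWindow n),
        OverlapDetection.optimalErrorProb n (ℓ n) Q P W ≤
          2 * (1 + ε n) *
            OverlapDetection.minInv β
              (OverlapDetection.mutualInfo (Fintype.card 𝒳) (OverlapDetection.pairLaw P W)) *
            (Real.logb (Fintype.card 𝒳) (n : ℝ) / (n : ℝ)) := by
  have hb : (1 : ℝ) < Fintype.card 𝒳 := by exact_mod_cast Fintype.one_lt_card
  set b : ℝ := ((Fintype.card 𝒳 : ℕ) : ℝ)
  set I := OverlapDetection.mutualInfo b (OverlapDetection.pairLaw P W) with hI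
  have hI0 : 0 ≤ I := OverlapDetection.mutualInfo_nonneg hb _
  have hc : 0 < OverlapDetection.minInv β I := by
    unfold OverlapDetection.minInv
    split_ifs with h
    · exact hβ
    · exact lt_min hβ (one_div_pos.2 (hI0.lt_of_ne' h))
  have (n : ℕ+) : Nonempty (PMF (OverlapDetection.firstWindow n)) :=
    ⟨PMF.pure ⟨1, Finset.mem_Icc.2 ⟨le_rfl, by exact_mod_cast n.pos⟩⟩⟩
  obtain ⟨ε, hε, h⟩ := OverlapDetection.exists_tendsto_zero_of_forall_eventually_le
    (fun (n : ℕ+) (Q : PMF (OverlapDetection.firstWindow n)) =>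
      OverlapDetection.optimalErrorProb n (ℓ n) Q P W)
    (fun n : ℕ+ => 2 * OverlapDetection.minInv β I * (Real.logb b (n : ℝ) / n))
    (by
      filter_upwards [(OverlapDetection.tendsto_logb_pnat hb).eventually_gt_atTop 0] with n hn
      have hn0 : (0 : ℝ) < (n : ℕ) := by exact_mod_cast n.pos
      positivity)
    -- The detector is selected according to which term attains the minimum.
    (fun δ hδ => by
      have h1 := OverlapDetection.eventually_optimalErrorProb_le_of_length P W hb hβ hδ ℓ hℓ
      unfold OverlapDetection.minInv
      split_ifs with h
      · exact h1
      · rcases min_choice β (1 / I) with hm | hm <;> rw [hm]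
        · exact h1
        · exact OverlapDetection.eventually_optimalErrorProb_le_of_mutualInfo P W hb hδ
            (hI0.lt_of_ne' h) ℓ hℓ)
  refine ⟨ε, hε, ?_⟩
  filter_upwards [h] with n hn Q
  refine (hn Q).trans_eq ?_
  ring
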